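/- **Setting.** Let $\kappa$ be an uncountable strong limit cardinal, let $L$ be a first-order language with $|L|<\kappa$, and let $\mathfrak C$ be an infinite $L$-structure that is $\kappa$-saturated and $\kappa$-strongly homogeneous (a monster model of its complete theory). "Small" means of cardinality $<\kappa$. For a small index set $I$, a subset of $\mathfrak C^I$ is *type-definable* if, for some small $A\subseteq\mathfrak C$, it is the intersection of a small family of sets definable over $A$. An equivalence relation is *bounded* if it has a small number of classes. Let $G\subseteq\mathfrak C^I$ be a type-definable group (the set $G$ and the graph of its multiplication are type-definable), acting type-definably (i.e. with type-definable graph) on a type-definable set $X\subseteq\mathfrak C^J$, where $I,J$ are small. For a small set $A\subseteq \mathfrak C$ let $G^{000}_A$ be the smallest subgroup of $G$ of small index that is invariant under all automorphisms of $\mathfrak C$ fixing $A$ pointwise, i.e. the intersection of all such subgroups. For $H\le G$ let $E_H$ be the relation on $X$ of lying in the same $H$-orbit. For an equivalence relation $E$ on $X$ let $H_E$ be the group of all $g\in G$ which preserve every $E$-class setwise. A $G$-invariant equivalence relation $E$ on $X$ is *orbital* if $E=E_H$ for some subgroup $H\le G$. **Theorem.** Let $E$ be an orbital ($G$-invariant)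 equivalence relation on $X$ all of whose classes are $G^{000}_A$-invariant, for some small set $A$. Then the following are equivalent: 1. $E$ is type-definable; 2. each $E$-class is type-definable; 3. $H_E$ is type-definable; 4. there is a type-definable subgroup $H\le G$ such that $E=E_H$. Moreover, $E$ is bounded if and only if the set $X/G$ of $G$-orbits is small. If $E$ is bounded, then the sets $C\subseteq X/E$ whose preimage in $X$ is type-definable are the closed sets of a topology on $X/E$ (the logic topology), and conditions 1–4 are equivalent to $X/E$ being Hausdorff in this topology. -/

import Mathlib

open FirstOrder Cardinal
open scoped Pointwise

universe u

namespace MonsterModel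

/-- `M` is a monster model of its complete theory, with respect to the cardinal `κ`: `M` is
infinite, `κ` is an uncountable strong limit cardinal larger than the language, and `M` is
`κ`-saturated and `κ`-strongly homogeneous. -/
structure IsMonster (L : FirstOrder.Language.{u, u}) (κ : Cardinal.{u}) (M : Type u) [L.Structure M] :
    Prop where
  infinite : Infinite M
  strongLimit : κ.IsStrongLimit
  uncountable : ℵ₀ < κ
  card_language_lt : L.card < κ
  /-- `κ`-saturation: every finitely satisfiable family of subsets of `M` (that is, every partial
  type in one variable) definable over a set `A` of fewer than `κ` parameters is realised. -/
  saturated : ∀ A : Set M, #A < κ → ∀ S : Set (Set M), (∀ D ∈ S, A.Definable₁ L D) →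
    (∀ F ⊆ S, F.Finite → (⋂₀ F).Nonempty) → (⋂₀ S).Nonempty
  /-- `κ`-strong homogeneity: every partial elementary map whose domain has fewer than `κ`
  elements extends to an automorphism. -/
  homogeneous : ∀ (A : Set M) (f : A → M), #A < κ →
    (∀ φ : L.Formula A, φ.Realize (fun a : A => (a : M)) ↔ φ.Realize f) →
    ∃ σ : M ≃[L] M, ∀ a : A, σ a = f a

section

variable (L : FirstOrder.Language.{u, u}) (κ : Cardinal.{u}) {M : Type u} [L.Structure M]

/-- `s` is the intersection of a small family of sets definable over `A`. -/
def TypeDefinableOver {I : Type u} (A : Set M) (s : Set (I → M)) : Prop :=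
  ∃ S : Set (Set (I → M)), #S < κ ∧ (∀ D ∈ S, A.Definable L D) ∧ s = ⋂₀ S

/-- `s` is type-definable: it is type-definable over some small set of parameters. -/
def TypeDefinable {I : Type u} (s : Set (I → M)) : Prop :=
  ∃ A : Set M, #A < κ ∧ TypeDefinableOver L κ A s

/-- `s` is setwise invariant under all automorphisms fixing `A` pointwise. -/
def InvariantOver {I : Type u} (A : Set M) (s : Set (I → M)) : Prop :=
  ∀ σ : M ≃[L] M, (∀ a ∈ A, σ a = a) → (fun x : I → M => (fun i => σ (x i))) '' s = s

/-- A subset of a set `X` of tuples, viewed as a set of tuples. -/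
def asTuples {I : Type u} {X : Set (I → M)} (s : Set X) : Set (I → M) :=
  Subtype.val '' s

/-- The graph of a binary operation `X × Y → Z` between sets of tuples. -/
def graph₂ {I J K : Type u} {X : Set (I → M)} {Y : Set (J → M)} {Z : Set (K → M)}
    (f : X → Y → Z) : Set (I ⊕ J ⊕ K → M) :=
  {t | ∃ (x : X) (y : Y), t = Sum.elim x.1 (Sum.elim y.1 (f x y).1)}

/-- A binary relation on a set of tuples, viewed as a set of pairs of tuples. -/
def relTuples {J : Type u} {X : Set (J → M)} (R : X → X → Prop) : Set (J ⊕ J → M) :=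
  {t | ∃ x y : X, R x y ∧ t = Sum.elim x.1 y.1}

/-- `G` with the given group law is a type-definable group. -/
structure IsTypeDefinableGroup {I : Type u} (G : Set (I → M)) [Group G] : Prop where
  index_small : #I < κ
  carrier : TypeDefinable L κ G
  mul : TypeDefinable L κ (graph₂ fun g h : G => g * h)

/-- `X` is a type-definable set and the given action of `G` on it is type-definable. -/
structure IsTypeDefinableAction {I J : Type u} (G : Set (I → M)) [Group G] (X : Set (J → M))
    [MulAction G X] : Prop where
  index_small : #J < κ
  carrier : TypeDefinable L κ X
  smul : TypeDefinable L κ (graph₂ fun (g : G) (x : X) => g • x)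

/-- The connected component `G^{000}_A`: the smallest subgroup of `G` of small index which is
invariant over `A`, constructed as the intersection of all such subgroups. -/
def G000 {I : Type u} (G : Set (I → M)) [Group G] (A : Set M) : Subgroup G :=
  sInf {K : Subgroup G | InvariantOver L A (asTuples (K : Set G)) ∧ #(G ⧸ K) < κ}

/-- `τ` is the logic topology on `X/E`: the closed sets are precisely those with type-definable
preimage in `X`. -/
def IsLogicTopology {J : Type u} {X : Set (J → M)} (E : Setoid X)
    (τ : TopologicalSpace (Quotient E)) : Prop :=
  ∀ C : Set (Quotient E), @IsClosed _ τ C ↔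
    TypeDefinable L κ (asTuples {x : X | (Quotient.mk E x) ∈ C})

end

section

variable (G : Type*) [Group G] {X : Type*} [MulAction G X]

/-- The relation `E` is `G`-invariant. -/
def IsInvariantRel (E : Setoid X) : Prop :=
  ∀ (g : G) (x y : X), E x y ↔ E (g • x) (g • y)

/-- `E` is orbital: it is invariant and is the orbit equivalence relation `E_H` of some subgroup
`H` of `G`. -/
def IsOrbital (E : Setoid X) : Prop :=
  IsInvariantRel G E ∧ ∃ H : Subgroup G, E = MulAction.orbitRel H X

/-- The group `H_E` of all elements of `G` which preserve every `E`-class setwise. -/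
def classStabilizer (E : Setoid X) : Subgroup G :=
  ⨅ C ∈ E.classes, MulAction.stabilizer G C

end

end MonsterModel

/-! Write N for `G000 L κ G A`. The crux is that type-definable classes force H_E to be
type-definable. H_E is the intersection, over all points x, of the sets {g : E (g • x) x}. Each is
type-definable, but with parameters depending on x, and there may be too many x. However, each is a
union of cosets gN, because E is G-invariant and N preserves its classes. Since N has small index,
automorphisms fixing a suitable small set preserve every coset of N. By saturation and homogeneity
(`closedOver_of_invariant`), all these sets are then type-definable over one small set, and so is
their intersection. The remaining implications are projections of type-definable sets, plus the fact
that an orbital E is the orbit relation of H_E.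

N has small index by an Erdős–Rado argument (`mk_quotient_G000_lt`): otherwise two elements
inequivalent modulo some invariant K of small index would yield a sequence, longer than the index of
K, of elements pairwise inequivalent modulo K.

If E is bounded, automorphisms over a small set also preserve every class, so one parameter set
serves all closed sets and the logic topology exists. Compactness separates classes when E is
type-definable; conversely, closed points are type-definable classes. -/

namespace MonsterModel

/-! ### Definable sets in infinitely many coordinates -/

section Definability

variable {L : FirstOrder.Language.{u, u}} {M : Type u} [L.Structure M] {A : Set M} {V W : Type u}

/-- A definable set depends on finitely many coordinates only. -/
theorem exists_finset_definable {D : Set (V → M)} (hD : A.Definable L D) :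
    ∃ (s : Finset V) (D' : Set (s → M)), A.Definable L D' ∧
      D = {x | (fun i : s => x i) ∈ D'} := by
  classical
  obtain ⟨φ, rfl⟩ := hD
  refine ⟨φ.freeVarFinset, {x | Language.Formula.Realize (φ.restrictFreeVar id) x}, ⟨_, rfl⟩, ?_⟩
  ext x
  exact (Language.BoundedFormula.realize_restrictFreeVar (φ := φ) (f := id) x (fun _ => rfl)).symm

/-- Projections of definable sets to a (possibly infinite) set of coordinates are definable. -/
theorem definable_image_comp [Nonempty M] {D : Set (V → M)} (hD : A.Definable L D) {f : W → V}
    (hf : f.Injective) : A.Definable L ((fun x : V → M => x ∘ f) '' D) := by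
  classical
  obtain ⟨s, D', hD', rfl⟩ := exists_finset_definable hD
  let t : Finset W := s.preimage f hf.injOn
  let ft : t → s := fun w => ⟨f w, Finset.mem_preimage.1 w.2⟩
  have h := (hD'.image_comp ft).preimage_comp (fun w : t => (w : W))
  convert h using 1
  ext x
  constructor
  · rintro ⟨y, hy, rfl⟩
    exact ⟨_, hy, rfl⟩
  · rintro ⟨z, hz, hzx⟩
    -- Only the coordinates in `s` matter for membership, so the others are free to be copied from
    -- `x` along `f`.
    let y : V → M := fun v => if hv : v ∈ s then z ⟨v, hv⟩ else
      if hw : ∃ w, f w = v then x hw.choose else Classical.arbitrary M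
    refine ⟨y, ?_, ?_⟩
    · have : (fun i : s => y i) = z := by
        funext i
        simp [y]
      simpa [this] using hz
    · funext w
      by_cases hv : f w ∈ s
      · have := congrFun hzx ⟨w, Finset.mem_preimage.2 hv⟩
        simpa [y, hv, ft] using this
      · have hw : ∃ w', f w' = f w := ⟨w, rfl⟩
        simp only [y, Function.comp, hv, hw, dif_pos, dif_neg, not_false_eq_true]
        rw [hf hw.choose_spec]

theorem definable_sInter {F : Set (Set (V → M))} (hF : F.Finite)
    (h : ∀ D ∈ F, A.Definable L D) : A.Definable L (⋂₀ F) := by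
  have : Finite F := hF
  rw [Set.sInter_eq_iInter]
  exact Set.definable_iInter_of_finite fun D => h D D.2

theorem definable_coord_eq {m : M} (hm : m ∈ A) (v : V) :
    A.Definable L {x : V → M | x v = m} := by
  rw [Set.definable_iff_exists_formula_sum]
  refine ⟨(Language.var (Sum.inr v) : L.Term (A ⊕ V)).equal (Language.var (Sum.inl ⟨m, hm⟩)), ?_⟩
  ext x
  simp [Language.Formula.realize_equal]

/-- The family `S` has the finite intersection property. -/
def FinitelySatisfiable {α : Type*} (S : Set (Set α)) : Prop :=
  ∀ F ⊆ S, F.Finite → (⋂₀ F).Nonempty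

end Definability

/-! ### Saturation and homogeneity for small tuples -/

namespace IsMonster

variable {L : FirstOrder.Language.{u, u}} {κ : Cardinal.{u}} {M : Type u} [L.Structure M]
  {V W : Type u}

theorem nonempty (hM : IsMonster L κ M) : Nonempty M :=
  have := hM.infinite
  inferInstance

theorem aleph0_le (hM : IsMonster L κ M) : ℵ₀ ≤ κ := hM.uncountable.le

theorem mk_union_lt (hM : IsMonster L κ M) {A B : Set M} (hA : #A < κ) (hB : #B < κ) :
    #(A ∪ B : Set M) < κ :=
  (mk_union_le A B).trans_lt (add_lt_of_lt hM.aleph0_le hA hB)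

theorem mk_sum_lt (hM : IsMonster L κ M) (hV : #V < κ) (hW : #W < κ) : #(V ⊕ W) < κ := by
  rw [mk_sum, lift_id, lift_id]
  exact add_lt_of_lt hM.aleph0_le hV hW

theorem mk_prod_lt (hM : IsMonster L κ M) (hV : #V < κ) (hW : #W < κ) : #(V × W) < κ := by
  rw [mk_prod, lift_id, lift_id]
  exact mul_lt_of_lt hM.aleph0_le hV hW

theorem mk_range_lt (hV : #V < κ) (x : V → M) : #(Set.range x) < κ :=
  mk_range_le.trans_lt hV

/-- A partial type in one coordinate is realised. -/
theorem exists_coord (hM : IsMonster L κ M) {A : Set M} (hA : #A < κ)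
    {T : Set (Set (V → M))} (hT : ∀ D ∈ T, A.Definable L D) (hfin : FinitelySatisfiable T) (v : V) :
    ∃ m : M, ∀ F ⊆ T, F.Finite → ∃ x ∈ ⋂₀ F, x v = m := by
  have := hM.nonempty
  let S : Set (Set M) := {Y | ∃ F ⊆ T, F.Finite ∧ Y = (fun x => x v) '' ⋂₀ F}
  have hdef : ∀ Y ∈ S, A.Definable₁ L Y := by
    rintro _ ⟨F, hF, hFf, rfl⟩
    have h := (definable_image_comp (definable_sInter hFf fun D hD => hT D (hF hD))
      (f := fun _ : PUnit.{u + 1} => v) (fun _ _ _ => rfl)).preimage_comp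
        (fun _ : PUnit.{u + 1} => (0 : Fin 1))
    rw [Set.Definable₁]
    convert h using 1
    ext y
    constructor
    · rintro ⟨x, hx, hxy⟩
      exact ⟨x, hx, funext fun _ => hxy⟩
    · rintro ⟨x, hx, hxy⟩
      exact ⟨x, hx, congrFun hxy PUnit.unit⟩
  have hS : ∀ F ⊆ S, F.Finite → (⋂₀ F).Nonempty := by
    intro F hF hFf
    have hF' : ∀ Y ∈ F, ∃ F' ⊆ T, F'.Finite ∧ Y = (fun x => x v) '' ⋂₀ F' := hF
    choose! c hc using hF'
    obtain ⟨x, hx⟩ := hfin (⋃ Y ∈ F, c Y) (Set.iUnion₂_subset fun Y hY => (hc Y hY).1)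
      (hFf.biUnion fun Y hY => (hc Y hY).2.1)
    refine ⟨x v, fun Y hY => ?_⟩
    rw [(hc Y hY).2.2]
    exact ⟨x, fun D hD => hx D (Set.mem_biUnion hY hD), rfl⟩
  obtain ⟨m, hm⟩ := hM.saturated A hA S hdef hS
  exact ⟨m, fun F hF hFf => hm _ ⟨F, hF, hFf, rfl⟩⟩

/-- Saturation in any small number of variables. -/
theorem sInter_nonempty (hM : IsMonster L κ M) (hV : #V < κ) {A : Set M} (hA : #A < κ)
    {S : Set (Set (V → M))} (hS : ∀ D ∈ S, A.Definable L D) (hfin : FinitelySatisfiable S) :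
    (⋂₀ S).Nonempty := by
  classical
  let e : V × M → Set (V → M) := fun p => {x | x p.1 = p.2}
  -- Sets of assignments `x v = m` consistent with `S`. Consistency has finite character, so a
  -- maximal one exists; it will be the graph of a realisation.
  let 𝓡 : Set (Set (V × M)) := {R | FinitelySatisfiable (S ∪ e '' R)}
  have hchar : Order.IsOfFiniteCharacter 𝓡 := by
    refine fun R => ⟨fun h Q hQ _ F hF => h F (hF.trans ?_), fun h F hF hFf => ?_⟩
    · exact Set.union_subset_union_right _ (Set.image_mono hQ)
    · obtain ⟨Q, hQR, hQ, hFQ⟩ := Set.exists_subset_image_finite_and.1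
        ⟨F ∩ e '' R, Set.inter_subset_right, hFf.inter_of_left _, subset_rfl⟩
      refine h Q hQR hQ F (fun D hD => ?_) hFf
      rcases hF hD with h' | h'
      · exact Or.inl h'
      · exact Or.inr (hFQ ⟨hD, h'⟩)
  have h0 : (∅ : Set (V × M)) ∈ 𝓡 := by simpa [𝓡] using hfin
  obtain ⟨R, -, hR⟩ := hchar.exists_maximal h0
  have hRfin : FinitelySatisfiable (S ∪ e '' R) := hR.prop
  have huniq : ∀ v m m', (v, m) ∈ R → (v, m') ∈ R → m = m' := by
    intro v m m' h h'
    obtain ⟨x, hx⟩ := hRfin {e (v, m), e (v, m')} (by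
      rintro _ (rfl | rfl)
      · exact Or.inr ⟨_, h, rfl⟩
      · exact Or.inr ⟨_, h', rfl⟩) (by simp)
    have h1 : x v = m := hx _ (Or.inl rfl)
    have h2 : x v = m' := hx _ (Or.inr rfl)
    exact h1.symm.trans h2
  -- As the graph of a partial function on `V`, `R` adds only a small set of parameters, so
  -- one-variable saturation still applies.
  have hRV : #R < κ := by
    refine lt_of_le_of_lt (mk_le_of_injective (f := fun p : R => p.1.1) ?_) hV
    rintro ⟨⟨v, m⟩, h⟩ ⟨⟨v', m'⟩, h'⟩ (rfl : v = v')
    simp [huniq v m m' h h']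
  have hA' : #(A ∪ Prod.snd '' R : Set M) < κ :=
    hM.mk_union_lt hA (mk_image_le.trans_lt hRV)
  have htot : ∀ v, ∃ m, (v, m) ∈ R := by
    intro v
    obtain ⟨m, hm⟩ := hM.exists_coord hA' (T := S ∪ e '' R) (by
      rintro D (hD | ⟨⟨w, n⟩, hp, rfl⟩)
      · exact (hS D hD).mono Set.subset_union_left
      · exact definable_coord_eq (m := n) (Or.inr ⟨_, hp, rfl⟩) w) hRfin v
    refine ⟨m, hR.le_of_ge (y := insert (v, m) R) ?_ (Set.subset_insert _ _)
      (Set.mem_insert _ _)⟩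
    intro F hF hFf
    obtain ⟨x, hx, hxv⟩ := hm (F \ {e (v, m)}) (by
      rintro D ⟨hD, hne⟩
      rcases hF hD with h | ⟨p, hp, rfl⟩
      · exact Or.inl h
      · rcases hp with rfl | hp
        · exact absurd rfl hne
        · exact Or.inr ⟨p, hp, rfl⟩) (hFf.subset Set.sdiff_subset)
    refine ⟨x, fun D hD => ?_⟩
    by_cases h : D = e (v, m)
    · rw [h]
      exact hxv
    · exact hx D ⟨hD, h⟩
  choose x hx using htot
  refine ⟨x, fun D hD => ?_⟩
  obtain ⟨s, D', -, rfl⟩ := exists_finset_definable (hS D hD)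
  obtain ⟨y, hy⟩ := hRfin (insert {z : V → M | (fun i : s => z i) ∈ D'}
      ((fun v => e (v, x v)) '' (s : Set V))) (by
    rintro _ (rfl | ⟨v, -, rfl⟩)
    · exact Or.inl hD
    · exact Or.inr ⟨_, hx v, rfl⟩) ((s.finite_toSet.image _).insert _)
  have h1 : (fun i : s => y i) ∈ D' := hy _ (Set.mem_insert _ _)
  have h2 : (fun i : s => x i) = fun i : s => y i := by
    funext i
    exact (hy _ (Set.mem_insert_of_mem _ ⟨i, i.2, rfl⟩) : y i = x i).symm
  rw [← h2] at h1
  exact h1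

/-- Two tuples which satisfy the same formulas over a small set are conjugate over it. -/
theorem exists_equiv (hM : IsMonster L κ M) (hV : #V < κ) {A : Set M} (hA : #A < κ) {y z : V → M}
    (h : ∀ D : Set (V → M), A.Definable L D → y ∈ D → z ∈ D) :
    ∃ σ : M ≃[L] M, (∀ a ∈ A, σ a = a) ∧ σ ∘ y = z := by
  have hform : ∀ φ : L.Formula (A ⊕ V), φ.Realize (Sum.elim (↑) y) → φ.Realize (Sum.elim (↑) z) :=
    fun φ => h {x | φ.Realize (Sum.elim Subtype.val x)}
      (Set.definable_iff_exists_formula_sum.2 ⟨φ, rfl⟩)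
  let C : Set M := A ∪ Set.range y
  have hk : ∀ c : C, ∃ k : A ⊕ V, (Sum.elim (↑) y k : M) = c := by
    rintro ⟨c, hc | ⟨v, rfl⟩⟩
    · exact ⟨Sum.inl ⟨c, hc⟩, rfl⟩
    · exact ⟨Sum.inr v, rfl⟩
  choose k hk using hk
  let f : C → M := fun c => Sum.elim (↑) z (k c)
  have hy : (Sum.elim (↑) y : A ⊕ V → M) ∘ k = (↑) := funext hk
  have hreal : ∀ φ : L.Formula C, φ.Realize (fun c : C => (c : M)) → φ.Realize f := by
    intro φ hφ
    have := hform (φ.relabel k) (by rw [Language.Formula.realize_relabel, hy]; exact hφ)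
    rwa [Language.Formula.realize_relabel] at this
  obtain ⟨σ, hσ⟩ := hM.homogeneous C f (hM.mk_union_lt hA (mk_range_lt hV y)) fun φ =>
    ⟨hreal φ, fun h => by
      by_contra h'
      exact hreal φ.not (by rwa [Language.Formula.realize_not]) h⟩
  -- `k` picks one name for each element of `C`; other names agree because equality of two names is
  -- a formula passing from `y` to `z`.
  have key : ∀ j : A ⊕ V, σ (Sum.elim (↑) y j) = Sum.elim (↑) z j := by
    intro j
    have hj : (Sum.elim (↑) y j : M) ∈ C := by
      rcases j with a | v
      · exact Or.inl a.2
      · exact Or.inr ⟨v, rfl⟩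
    have h1 := hσ ⟨_, hj⟩
    have h2 := hform
      ((Language.var (k ⟨_, hj⟩) : L.Term (A ⊕ V)).equal (Language.var j))
      (by simpa [Language.Formula.realize_equal] using hk ⟨_, hj⟩)
    rw [Language.Formula.realize_equal] at h2
    exact h1.trans h2
  exact ⟨σ, fun a ha => key (Sum.inl ⟨a, ha⟩), funext fun v => key (Sum.inr v)⟩

theorem mk_formula_lt (hM : IsMonster L κ M) (hV : #V < κ) : #(L.Formula V) < κ := by
  have h1 : #(L.Formula V) ≤ #(Σ n, L.BoundedFormula V n) :=
    mk_le_of_injective (f := fun φ : L.Formula V => (⟨0, φ⟩ : Σ n, L.BoundedFormula V n))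
      fun φ ψ h => by simpa using h
  refine (h1.trans Language.BoundedFormula.card_le).trans_lt (max_lt hM.uncountable ?_)
  rw [lift_id, lift_id]
  exact add_lt_of_lt hM.aleph0_le hV hM.card_language_lt

theorem mk_definable_lt (hM : IsMonster L κ M) (hV : #V < κ) {A : Set M} (hA : #A < κ) :
    #{D : Set (V → M) | A.Definable L D} < κ := by
  refine lt_of_le_of_lt ?_ (hM.mk_formula_lt (hM.mk_sum_lt hA hV))
  refine le_trans (mk_le_mk_of_subset ?_)
    (mk_range_le (f := fun φ : L.Formula (A ⊕ V) => {x : V → M | φ.Realize (Sum.elim (↑) x)}))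
  intro D hD
  obtain ⟨φ, rfl⟩ := Set.definable_iff_exists_formula_sum.1 hD
  exact ⟨φ, rfl⟩

end IsMonster

end MonsterModel

namespace MonsterModel

/-! ### An Erdős–Rado argument -/

section Combinatorics

variable {α C Q : Type u}

/-- Shapes of the terms which close a set under solutions of systems of equations for `c`. -/
abbrev SolutionShape (C : Type u) : Type u := Option (C × ℕ → C)

/-- Arities of the shapes. -/
abbrev SolutionArity (C : Type u) : SolutionShape C → Type u
  | none => PEmpty
  | some _ => C × ℕ

open Classical in
/-- The value of a term: a solution `b` of the system of equations `c (x i) b = f i`. -/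
noncomputable def solutionValue [Nonempty α] (c : α → α → C) : WType (SolutionArity C) → α
  | ⟨none, _⟩ => Classical.arbitrary α
  | ⟨some f, x⟩ =>
    if h : ∃ b, ∀ i, c (solutionValue c (x i)) b = f i then h.choose else Classical.arbitrary α

/-- There are at most `2 ^ μ` shapes, each of arity at most `μ`, and `(2 ^ μ) ^ μ = 2 ^ μ`, so
forming terms never leaves this bound. -/
theorem mk_solutionTerms_le {μ : Cardinal.{u}} (hμ : ℵ₀ ≤ μ) (hC : #C ≤ μ) :
    #(WType (SolutionArity C)) ≤ 2 ^ μ := by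
  have hinf : ℵ₀ ≤ 2 ^ μ := hμ.trans (cantor μ).le
  have hpos : (1 : Cardinal.{u}) ≤ 2 ^ μ := one_lt_aleph0.le.trans hinf
  have hCN : #(C × ℕ) ≤ μ := by
    rw [mk_prod, lift_id', mk_nat, lift_aleph0]
    exact mul_le_of_le hμ hC hμ
  have hpow : ((2 : Cardinal.{u}) ^ μ) ^ #(C × ℕ) ≤ 2 ^ μ := by
    rw [← power_mul]
    exact power_le_power_left two_ne_zero (mul_le_of_le hμ le_rfl hCN)
  have hshape : #(SolutionShape C) ≤ 2 ^ μ := by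
    rw [mk_option]
    refine add_le_of_le hinf ?_ hpos
    rw [← power_def]
    exact (power_le_power_right (hC.trans (cantor μ).le)).trans hpow
  refine WType.cardinalMk_le_of_le ((sum_le_sum _ (fun _ => 2 ^ μ) ?_).trans ?_)
  · rintro (_ | f)
    · simpa using hpos
    · exact hpow
  · rw [sum_const']
    exact mul_le_of_le hinf hshape le_rfl

/-- There is a set `B` of at most `2 ^ μ` points (given as a range) in which every system of
equations for the colouring `c`, with parameters from `B`, is solvable if it is solvable. -/
theorem exists_closed_range [Nonempty α] (c : α → α → C) {μ : Cardinal.{u}} (hμ : ℵ₀ ≤ μ)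
    (hC : #C ≤ μ) : ∃ B : Set α, #B ≤ 2 ^ μ ∧ B.Nonempty ∧
      ∀ x : C × ℕ → α, (∀ i, x i ∈ B) → ∀ g, ∃ b ∈ B, ∀ i, c (x i) b = c (x i) g := by
  refine ⟨Set.range (solutionValue c), mk_range_le.trans (mk_solutionTerms_le hμ hC),
    ⟨_, ⟨none, PEmpty.elim⟩, rfl⟩, fun x hx g => ?_⟩
  choose w hw using hx
  have h : ∃ b, ∀ i, c (solutionValue c (w i)) b = c (x i) g := ⟨g, fun i => by rw [hw]⟩
  refine ⟨_, ⟨⟨some fun i => c (x i) g, w⟩, rfl⟩, fun i => ?_⟩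
  rw [solutionValue, dif_pos h, ← hw i]
  simpa [hw] using h.choose_spec i

/-- A form of the Erdős–Rado theorem: if `q` takes more than `2 ^ μ` values, then, for every
colouring of the pairs in `μ` colours, the colour of some pair with distinct values of `q` admits
arbitrarily long finite homogeneous sequences. -/
theorem exists_long_homogeneous [Nonempty α] (c : α → α → C) {q : α → Q} (hq : q.Surjective)
    {μ : Cardinal.{u}} (hμ : ℵ₀ ≤ μ) (hC : #C ≤ μ) (h : 2 ^ μ < #Q) :
    ∃ a g, q a ≠ q g ∧ ∀ n : ℕ, ∃ f : ℕ → α, ∀ i j, i < j → j < n → c (f i) (f j) = c a g := by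
  obtain ⟨B, hB, ⟨b₀, hb₀⟩, hsol⟩ := exists_closed_range c hμ hC
  have hg : ∃ g, q g ∉ q '' B := by
    by_contra! hcon
    refine (mk_image_le.trans hB : #(q '' B) ≤ 2 ^ μ).not_gt ?_
    rwa [Set.eq_univ_of_forall (s := q '' B) fun y => (hq y).elim fun g hg => hg ▸ hcon g, mk_univ]
  obtain ⟨g, hg⟩ := hg
  -- Homogeneous sequences in `B` that `g` itself would prolong; only the first `n` entries matter
  -- for the colours.
  let P : C → ℕ → (ℕ → α) → Prop := fun t n f => (∀ i, f i ∈ B) ∧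
    (∀ i j, i < j → j < n → c (f i) (f j) = t) ∧ ∀ i < n, c (f i) g = t
  have hP : ∃ t, ∀ n, ∃ f, P t n f := by
    by_contra! hcon
    have hmax : ∀ t, ∃ n f, P t n f ∧ ∀ f', ¬ P t (n + 1) f' := by
      intro t
      by_contra! hstep
      obtain ⟨n, hn⟩ := hcon t
      have : ∀ n, ∃ f, P t n f := by
        intro n
        induction n with
        | zero => exact ⟨fun _ => b₀, fun _ => hb₀, by simp, by simp⟩
        | succ n ih =>
          obtain ⟨f, hf⟩ := ih
          exact hstep n f hf
      obtain ⟨f, hf⟩ := this n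
      exact hn f hf
    choose n f hf hfmax using hmax
    -- A single `b` in `B` imitates `g` over the maximal sequences of all colours at once. It
    -- therefore prolongs the one whose colour is that of `(b, g)`, a contradiction.
    obtain ⟨b, hbB, hb⟩ := hsol (fun p => f p.1 p.2) (fun p => (hf p.1).1 p.2) g
    let t := c b g
    refine hfmax t (fun i => if i < n t then f t i else b) ⟨fun i => ?_, fun i j hij hj => ?_,
      fun i hi => ?_⟩
    · dsimp only
      split_ifs
      · exact (hf t).1 i
      · exact hbB
    · have hi : i < n t := by omega
      simp only [hi, if_true]
      split_ifs with hj'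
      · exact (hf t).2.1 i j hij hj'
      · exact (hb (t, i)).trans ((hf t).2.2 i hi)
    · dsimp only
      split_ifs with hi'
      · exact (hf t).2.2 i hi'
      · rfl
  obtain ⟨t, ht⟩ := hP
  obtain ⟨f, hf⟩ := ht 1
  refine ⟨f 0, g, fun hne => hg ⟨_, hf.1 0, hne⟩, fun n => ?_⟩
  obtain ⟨f', hf'⟩ := ht n
  exact ⟨f', by rw [hf.2.2 0 one_pos]; exact hf'.2.1⟩

end Combinatorics

/-! ### Type-definability over a fixed parameter set -/

section ClosedOver

variable {L : FirstOrder.Language.{u, u}} {M : Type u} [L.Structure M] {A B : Set M}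
  {V W : Type u}

variable (L) in
/-- `s` is an intersection of sets definable over `A`. -/
def ClosedOver (A : Set M) (s : Set (V → M)) : Prop :=
  ∀ x ∉ s, ∃ D, A.Definable L D ∧ s ⊆ D ∧ x ∉ D

theorem ClosedOver.of_definable {s : Set (V → M)} (h : A.Definable L s) : ClosedOver L A s :=
  fun _ hx => ⟨s, h, subset_rfl, hx⟩

theorem TypeDefinableOver.closedOver {κ : Cardinal.{u}} {s : Set (V → M)}
    (h : TypeDefinableOver L κ A s) : ClosedOver L A s := by
  obtain ⟨S, -, hS, rfl⟩ := h
  intro x hx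
  simp only [Set.mem_sInter, not_forall] at hx
  obtain ⟨D, hD, hxD⟩ := hx
  exact ⟨D, hS D hD, Set.sInter_subset_of_mem hD, hxD⟩

theorem ClosedOver.mono {s : Set (V → M)} (h : ClosedOver L A s) (hAB : A ⊆ B) :
    ClosedOver L B s := fun x hx =>
  let ⟨D, hD, h1, h2⟩ := h x hx
  ⟨D, hD.mono hAB, h1, h2⟩

theorem ClosedOver.iInter {ι : Sort*} {s : ι → Set (V → M)} (h : ∀ i, ClosedOver L A (s i)) :
    ClosedOver L A (⋂ i, s i) := by
  intro x hx
  simp only [Set.mem_iInter, not_forall] at hx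
  obtain ⟨i, hi⟩ := hx
  obtain ⟨D, hD, h1, h2⟩ := h i x hi
  exact ⟨D, hD, (Set.iInter_subset _ i).trans h1, h2⟩

theorem ClosedOver.inter {s t : Set (V → M)} (hs : ClosedOver L A s) (ht : ClosedOver L A t) :
    ClosedOver L A (s ∩ t) := by
  rw [Set.inter_eq_iInter]
  exact .iInter fun b => by cases b <;> assumption

theorem ClosedOver.union {s t : Set (V → M)} (hs : ClosedOver L A s) (ht : ClosedOver L A t) :
    ClosedOver L A (s ∪ t) := by
  intro x hx
  obtain ⟨D, hD, h1, h2⟩ := hs x fun h => hx (Or.inl h)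
  obtain ⟨D', hD', h1', h2'⟩ := ht x fun h => hx (Or.inr h)
  exact ⟨D ∪ D', hD.union hD', Set.union_subset_union h1 h1', fun h => h.elim h2 h2'⟩

theorem ClosedOver.preimage_comp {s : Set (V → M)} (hs : ClosedOver L A s) (f : V → W) :
    ClosedOver L A {x : W → M | x ∘ f ∈ s} := by
  intro x hx
  obtain ⟨D, hD, h1, h2⟩ := hs (x ∘ f) hx
  exact ⟨_, hD.preimage_comp f, fun y hy => h1 hy, h2⟩

theorem ClosedOver.singleton (x : V → M) : ClosedOver L (Set.range x) {x} := by
  intro y hy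
  obtain ⟨v, hv⟩ := Function.ne_iff.1 (show y ≠ x from hy)
  exact ⟨_, definable_coord_eq (Set.mem_range_self v) v, by rintro _ rfl; rfl, hv⟩

/-- A definable set is preserved by the automorphisms which fix its parameters. -/
theorem definable_map {D : Set (V → M)} (hD : A.Definable L D) {σ : M ≃[L] M}
    (hσ : ∀ a ∈ A, σ a = a) {x : V → M} : σ ∘ x ∈ D ↔ x ∈ D := by
  obtain ⟨φ, rfl⟩ := Set.definable_iff_exists_formula_sum.1 hD
  have h : (Sum.elim (↑) (σ ∘ x) : A ⊕ V → M) = σ ∘ Sum.elim (↑) x := by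
    funext k
    rcases k with a | v
    · exact (hσ a a.2).symm
    · rfl
  simp only [Set.mem_ofPred_eq, h]
  exact Language.StrongHomClass.realize_formula σ φ

theorem ClosedOver.map {s : Set (V → M)} (hs : ClosedOver L A s) {σ : M ≃[L] M}
    (hσ : ∀ a ∈ A, σ a = a) {x : V → M} (hx : x ∈ s) : σ ∘ x ∈ s := by
  by_contra h
  obtain ⟨D, hD, h1, h2⟩ := hs _ h
  exact h2 ((definable_map hD hσ).2 (h1 hx))

/-- Maps with type-definable graph commute with automorphisms. -/
theorem graph₂_map {I J K : Type u} {X : Set (I → M)} {Y : Set (J → M)} {Z : Set (K → M)}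
    {f : X → Y → Z} (hf : ClosedOver L A (graph₂ f)) {σ : M ≃[L] M} (hσ : ∀ a ∈ A, σ a = a)
    {x x' : X} {y y' : Y} (hx : x'.1 = σ ∘ x.1) (hy : y'.1 = σ ∘ y.1) :
    (f x' y').1 = σ ∘ (f x y).1 := by
  obtain ⟨x'', y'', h⟩ := hf.map hσ ⟨x, y, rfl⟩
  have h1 : σ ∘ x.1 = x''.1 := funext fun i => congrFun h (Sum.inl i)
  have h2 : σ ∘ y.1 = y''.1 := funext fun i => congrFun h (Sum.inr (Sum.inl i))
  have h3 : σ ∘ (f x y).1 = (f x'' y'').1 := funext fun i => congrFun h (Sum.inr (Sum.inr i))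
  rw [h3, show x' = x'' from Subtype.ext (hx.trans h1), show y' = y'' from Subtype.ext (hy.trans h2)]

end ClosedOver

/-! ### Compactness, projections and invariance -/

namespace IsMonster

variable {L : FirstOrder.Language.{u, u}} {κ : Cardinal.{u}} {M : Type u} [L.Structure M]
  {V W : Type u} {A B : Set M}

/-- Only a small number of sets are definable over a small `A`, so the size of the defining family
need not be tracked. -/
theorem typeDefinable_of_closedOver (hM : IsMonster L κ M) (hV : #V < κ) (hA : #A < κ)
    {s : Set (V → M)} (hs : ClosedOver L A s) : TypeDefinable L κ s := by
  refine ⟨A, hA, {D | A.Definable L D ∧ s ⊆ D},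
    (mk_le_mk_of_subset fun D hD => hD.1).trans_lt (hM.mk_definable_lt hV hA), fun D hD => hD.1,
    subset_antisymm (fun x hx D hD => hD.2 hx) fun x hx => ?_⟩
  by_contra h
  obtain ⟨D, hD, h1, h2⟩ := hs x h
  exact h2 (hx D ⟨hD, h1⟩)

theorem _root_.MonsterModel.TypeDefinable.exists_closedOver {s : Set (V → M)}
    (hs : TypeDefinable L κ s) : ∃ A : Set M, #A < κ ∧ ClosedOver L A s :=
  let ⟨A, hA, h⟩ := hs
  ⟨A, hA, h.closedOver⟩

/-- If a type-definable set is disjoint from the set defined by a small type `T`, closed under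
finite intersections, then it is separated from a member of `T`. -/
theorem exists_separation (hM : IsMonster L κ M) (hV : #V < κ) (hA : #A < κ)
    (hB : #B < κ) {s : Set (V → M)} (hs : ClosedOver L A s) {T : Set (Set (V → M))}
    (hT : ∀ D ∈ T, B.Definable L D) (hdisj : s ∩ ⋂₀ T = ∅) :
    ∃ D F, A.Definable L D ∧ s ⊆ D ∧ F ⊆ T ∧ F.Finite ∧ D ∩ ⋂₀ F = ∅ := by
  by_contra! hcon
  obtain ⟨x, hx⟩ := hM.sInter_nonempty hV (hM.mk_union_lt hA hB)
    (S := {D | A.Definable L D ∧ s ⊆ D} ∪ T)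
    (by
      rintro D (hD | hD)
      · exact hD.1.mono Set.subset_union_left
      · exact (hT D hD).mono Set.subset_union_right)
    (by
      intro F hF hFf
      let F₁ := F ∩ {D | A.Definable L D ∧ s ⊆ D}
      have hF₁ : F₁.Finite := hFf.inter_of_left _
      obtain ⟨x, hx, hx'⟩ := hcon (⋂₀ F₁) (F ∩ T)
        (definable_sInter hF₁ fun D hD => hD.2.1) (Set.subset_sInter fun D hD => hD.2.2)
        Set.inter_subset_right (hFf.inter_of_left _)
      refine ⟨x, fun D hD => ?_⟩
      rcases hF hD with h | h
      · exact hx D ⟨hD, h⟩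
      · exact hx' D ⟨hD, h⟩)
  have hxs : x ∈ s := by
    by_contra h
    obtain ⟨D, hD, h1, h2⟩ := hs x h
    exact h2 (hx D (Or.inl ⟨hD, h1⟩))
  exact (Set.mem_empty_iff_false x).1 (hdisj ▸ ⟨hxs, fun D hD => hx D (Or.inr hD)⟩)

/-- Projections of type-definable sets are type-definable. -/
theorem closedOver_image_comp (hM : IsMonster L κ M) (hV : #V < κ) (hW : #W < κ) (hA : #A < κ)
    {s : Set (V → M)} (hs : ClosedOver L A s) {f : W → V} (hf : f.Injective) :
    ClosedOver L A ((fun x : V → M => x ∘ f) '' s) := by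
  have := hM.nonempty
  intro x hx
  obtain ⟨D, F, hD, hsD, hF, -, hdisj⟩ := hM.exists_separation hV hA
    (mk_range_lt hW x) hs
    (T := Set.range fun w => {y : V → M | y (f w) = x w})
    (by
      rintro _ ⟨w, rfl⟩
      exact definable_coord_eq (Set.mem_range_self w) (f w))
    (by
      rw [Set.eq_empty_iff_forall_notMem]
      rintro y ⟨hy, hyx⟩
      exact hx ⟨y, hy, funext fun w => hyx _ ⟨w, rfl⟩⟩)
  refine ⟨_, definable_image_comp hD hf, Set.image_mono hsD, ?_⟩
  rintro ⟨y, hy, rfl⟩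
  refine Set.eq_empty_iff_forall_notMem.1 hdisj y ⟨hy, fun D' hD' => ?_⟩
  obtain ⟨w, rfl⟩ := hF hD'
  rfl

/-- A type-definable set which is invariant over a small set `B` is type-definable over `B`. -/
theorem closedOver_of_invariant (hM : IsMonster L κ M) (hV : #V < κ) (hB : #B < κ)
    {s : Set (V → M)} (hs : TypeDefinable L κ s)
    (hinv : ∀ σ : M ≃[L] M, (∀ b ∈ B, σ b = b) → ∀ x ∈ s, σ ∘ x ∈ s) : ClosedOver L B s := by
  obtain ⟨A, hA, hsA⟩ := hs.exists_closedOver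
  by_contra hcon
  simp only [ClosedOver, not_forall, not_exists, not_and, not_not] at hcon
  obtain ⟨z, hz, hcon⟩ := hcon
  -- The complete type of `z` over `B` misses `s`: its realisations are conjugate to `z` over `B`,
  -- and `s` is invariant.
  obtain ⟨D, F, hD, hsD, hF, hFf, hdisj⟩ := hM.exists_separation hV hA hB hsA
    (T := {D | B.Definable L D ∧ z ∈ D})
    (fun D hD => hD.1)
    (by
      rw [Set.eq_empty_iff_forall_notMem]
      rintro y ⟨hy, hyz⟩
      obtain ⟨σ, hσ, rfl⟩ := hM.exists_equiv hV hB (y := y) (z := z) fun D hD hyD => by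
        by_contra h
        exact hyz _ ⟨hD.compl, h⟩ hyD
      exact hz (hinv σ hσ y hy))
  have h1 : B.Definable L (⋂₀ F)ᶜ := (definable_sInter hFf fun D hD => (hF hD).1).compl
  exact hcon _ h1 (fun x hx hxF => Set.eq_empty_iff_forall_notMem.1 hdisj x ⟨hsD hx, hxF⟩)
    fun D hD => (hF hD).2

end IsMonster

end MonsterModel

namespace MonsterModel

variable {L : FirstOrder.Language.{u, u}} {κ : Cardinal.{u}} {M : Type u} [L.Structure M]
  {I J : Type u} {G : Set (I → M)} [Group G] {X : Set (J → M)} [MulAction G X] {A B : Set M}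

/-! ### Small index of the connected component -/

section Component

theorem InvariantOver.mem_iff {I : Type u} {G : Set (I → M)} {K : Set G}
    (hK : InvariantOver L A (asTuples K)) {σ : M ≃[L] M}
    (hσ : ∀ a ∈ A, σ a = a) {g g' : G} (hg : g'.1 = σ ∘ g.1) : g' ∈ K ↔ g ∈ K := by
  have h := hK σ hσ
  constructor
  · intro hg'
    have h1 : g'.1 ∈ asTuples K := ⟨g', hg', rfl⟩
    rw [← h] at h1
    obtain ⟨_, ⟨k, hk, rfl⟩, hkg⟩ := h1
    have : k = g := Subtype.ext (funext fun i => σ.injective (congrFun (hkg.trans hg) i))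
    exact this ▸ hk
  · intro hg'
    have h1 : g'.1 ∈ asTuples K := by
      rw [← h]
      exact ⟨g.1, ⟨g, hg', rfl⟩, hg.symm⟩
    obtain ⟨k, hk, hkg⟩ := h1
    exact Subtype.ext hkg ▸ hk

theorem G000_map {σ : M ≃[L] M} (hσ : ∀ a ∈ A, σ a = a) {g g' : G} (hg : g'.1 = σ ∘ g.1)
    (h : g ∈ G000 L κ G A) : g' ∈ G000 L κ G A := by
  rw [G000, Subgroup.mem_sInf] at h ⊢
  exact fun K hK => (hK.1.mem_iff hσ hg).2 (h K hK)

theorem mul_map (hmul : ClosedOver L B (graph₂ fun g h : G => g * h)) {σ : M ≃[L] M}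
    (hσ : ∀ b ∈ B, σ b = b) {g g' h h' : G} (hg : g'.1 = σ ∘ g.1) (hh : h'.1 = σ ∘ h.1) :
    (g' * h').1 = σ ∘ (g * h).1 :=
  graph₂_map hmul hσ hg hh

/-- Only multiplication is assumed type-definable; apply the automorphism to `g * (g⁻¹ * h) = h` and
cancel. -/
theorem inv_mul_map (hG : ClosedOver L B G) (hmul : ClosedOver L B (graph₂ fun g h : G => g * h))
    {σ : M ≃[L] M} (hσ : ∀ b ∈ B, σ b = b) {g g' h h' : G} (hg : g'.1 = σ ∘ g.1)
    (hh : h'.1 = σ ∘ h.1) : (g'⁻¹ * h').1 = σ ∘ (g⁻¹ * h).1 := by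
  have h1 := mul_map hmul hσ (h := g⁻¹ * h) (h' := ⟨_, hG.map hσ (g⁻¹ * h).2⟩) hg rfl
  rw [mul_inv_cancel_left, ← hh] at h1
  rw [← Subtype.ext h1, inv_mul_cancel_left]

theorem IsTypeDefinableGroup.exists_base (hG : IsTypeDefinableGroup L κ G)
    (hM : IsMonster L κ M) (hA : #A < κ) :
    ∃ B : Set M, #B < κ ∧ A ⊆ B ∧ ClosedOver L B G ∧
      ClosedOver L B (graph₂ fun g h : G => g * h) := by
  obtain ⟨B₁, hB₁, h₁⟩ := hG.carrier.exists_closedOver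
  obtain ⟨B₂, hB₂, h₂⟩ := hG.mul.exists_closedOver
  exact ⟨A ∪ (B₁ ∪ B₂), hM.mk_union_lt hA (hM.mk_union_lt hB₁ hB₂), Set.subset_union_left,
    h₁.mono (Set.subset_union_left.trans Set.subset_union_right),
    h₂.mono (Set.subset_union_right.trans Set.subset_union_right)⟩

/-- If the type over `B` of a pair `(a, g)` is the type of all increasing pairs of arbitrarily long
finite sequences, then it is also the type of all increasing pairs of a sequence indexed by any
small linear order. -/
theorem IsMonster.exists_homogeneous (hM : IsMonster L κ M) (hI : #I < κ) (hB : #B < κ)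
    {a g : I → M}
    (h : ∀ n : ℕ, ∃ f : ℕ → I → M, ∀ i j, i < j → j < n → ∀ D : Set (I ⊕ I → M), B.Definable L D →
      Sum.elim a g ∈ D → Sum.elim (f i) (f j) ∈ D)
    {Λ : Type u} [LinearOrder Λ] (hΛ : #Λ < κ) :
    ∃ x : Λ → I → M, ∀ i j, i < j → ∃ σ : M ≃[L] M, (∀ b ∈ B, σ b = b) ∧
      σ ∘ a = x i ∧ σ ∘ g = x j := by
  classical
  let pair : Λ → Λ → I ⊕ I → Λ × I := fun i j => Sum.elim (fun k => (i, k)) (fun k => (j, k))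
  let S : Set (Set (Λ × I → M)) := {Y | ∃ i j, i < j ∧ ∃ D : Set (I ⊕ I → M), B.Definable L D ∧
    Sum.elim a g ∈ D ∧ Y = {x | x ∘ pair i j ∈ D}}
  obtain ⟨x, hx⟩ := hM.sInter_nonempty (hM.mk_prod_lt hΛ hI) hB (S := S)
    (by
      rintro _ ⟨i, j, -, D, hD, -, rfl⟩
      exact hD.preimage_comp (pair i j))
    (by
      intro F hF hFf
      have hF' : ∀ Y ∈ F, ∃ i j, i < j ∧ ∃ D : Set (I ⊕ I → M), B.Definable L D ∧
        Sum.elim a g ∈ D ∧ Y = {x | x ∘ pair i j ∈ D} := hF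
      by_cases hΛe : Nonempty Λ
      swap
      · refine ⟨fun p => (hΛe ⟨p.1⟩).elim, fun Y hY => ?_⟩
        obtain ⟨i, -⟩ := hF' Y hY
        exact (hΛe ⟨i⟩).elim
      choose! i j hij D hD hag hY using hF'
      let s : Finset Λ := hFf.toFinset.image i ∪ hFf.toFinset.image j
      -- The rank among the finitely many indices in use embeds them increasingly into the positions
      -- below `s.card`.
      let r : Λ → ℕ := fun k => (s.filter (· < k)).card
      obtain ⟨f, hf⟩ := h s.card
      refine ⟨fun p => f (r p.1) p.2, fun Y hYF => ?_⟩
      have hi : i Y ∈ s := Finset.mem_union_left _ (Finset.mem_image_of_mem _ (by simpa using hYF))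
      have hj : j Y ∈ s := Finset.mem_union_right _ (Finset.mem_image_of_mem _ (by simpa using hYF))
      have hr : r (i Y) < r (j Y) := by
        refine Finset.card_lt_card ⟨fun k hk => ?_, fun hsub => ?_⟩
        · rw [Finset.mem_filter] at hk ⊢
          exact ⟨hk.1, hk.2.trans (hij Y hYF)⟩
        · have := hsub (Finset.mem_filter.2 ⟨hi, hij Y hYF⟩)
          exact lt_irrefl _ (Finset.mem_filter.1 this).2
      have hr' : r (j Y) < s.card := by
        refine Finset.card_lt_card ⟨Finset.filter_subset _ _, fun hsub => ?_⟩
        exact lt_irrefl _ (Finset.mem_filter.1 (hsub hj)).2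
      rw [hY Y hYF]
      have hcomp : (fun p : Λ × I => f (r p.1) p.2) ∘ pair (i Y) (j Y) =
          Sum.elim (f (r (i Y))) (f (r (j Y))) := by
        funext k
        rcases k with k | k <;> rfl
      rw [Set.mem_ofPred_eq, hcomp]
      exact hf _ _ hr hr' (D Y) (hD Y hYF) (hag Y hYF))
  refine ⟨fun i k => x (i, k), fun i j hij => ?_⟩
  obtain ⟨σ, hσ, h⟩ := hM.exists_equiv (hM.mk_sum_lt hI hI) hB (y := Sum.elim a g)
    (z := x ∘ pair i j) fun D hD hag => hx _ ⟨i, j, hij, D, hD, hag, rfl⟩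
  exact ⟨σ, hσ, funext fun k => congrFun h (Sum.inl k), funext fun k => congrFun h (Sum.inr k)⟩

/-- The index of `G000` is small. -/
theorem mk_quotient_G000_lt (hM : IsMonster L κ M) (hG : IsTypeDefinableGroup L κ G)
    (hA : #A < κ) : #(G ⧸ G000 L κ G A) < κ := by
  obtain ⟨B, hB, hAB, hGB, hmul⟩ := hG.exists_base hM hA
  have hI := hG.index_small
  let 𝓓 : Type u := {D : Set (I ⊕ I → M) // B.Definable L D}
  -- Pairs are coloured by their complete type over `B`.
  let c : G → G → Set 𝓓 := fun a b => {D | Sum.elim a.1 b.1 ∈ D.1}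
  have h𝓓 : #𝓓 < κ := hM.mk_definable_lt (hM.mk_sum_lt hI hI) hB
  have hκ := hM.strongLimit
  let μ : Cardinal.{u} := max ℵ₀ #(Set 𝓓)
  have hμ : μ < κ := max_lt hM.uncountable (by rw [mk_set]; exact hκ.isStrongPrelimit h𝓓)
  by_contra hcon
  obtain ⟨a, g, hag, hlong⟩ := exists_long_homogeneous c
    (q := fun g : G => (g : G ⧸ G000 L κ G A)) QuotientGroup.mk_surjective (le_max_left _ _)
    (le_max_right ℵ₀ #(Set 𝓓)) ((hκ.isStrongPrelimit hμ).trans_le (not_lt.1 hcon))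
  have hK : ∃ K : Subgroup G, InvariantOver L A (asTuples (K : Set G)) ∧ #(G ⧸ K) < κ ∧
      a⁻¹ * g ∉ K := by
    by_contra! hK
    refine hag (QuotientGroup.eq.2 ?_)
    rw [G000, Subgroup.mem_sInf]
    exact fun K h => hK K h.1 h.2
  obtain ⟨K, hKA, hKκ, hKag⟩ := hK
  obtain ⟨x, hx⟩ := hM.exists_homogeneous hI hB (a := a.1) (g := g.1)
    (fun n => by
      obtain ⟨f, hf⟩ := hlong n
      refine ⟨fun i => (f i).1, fun i j hij hj D hD hD' => ?_⟩
      have : (⟨D, hD⟩ : 𝓓) ∈ c (f i) (f j) := by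
        rw [hf i j hij hj]
        exact hD'
      exact this)
    -- Longer than the number of cosets of `K`, yet still small because `κ` is a strong limit.
    (Λ := (2 ^ #(G ⧸ K) : Cardinal.{u}).ord.ToType)
    (by rw [mk_ord_toType]; exact hκ.isStrongPrelimit hKκ)
  have hpair : ∀ i j, i < j → ∃ (hi : x i ∈ G) (hj : x j ∈ G),
      ((⟨x i, hi⟩ : G) : G ⧸ K) ≠ ((⟨x j, hj⟩ : G) : G ⧸ K) := by
    intro i j hij
    obtain ⟨σ, hσ, hi, hj⟩ := hx i j hij
    refine ⟨hi ▸ hGB.map hσ a.2, hj ▸ hGB.map hσ g.2, fun hne => hKag ?_⟩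
    rw [QuotientGroup.eq] at hne
    exact (hKA.mem_iff (fun a ha => hσ a (hAB ha))
      (inv_mul_map hGB hmul hσ (g := a) (h := g) hi.symm hj.symm)).1 hne
  classical
  let q : (2 ^ #(G ⧸ K) : Cardinal.{u}).ord.ToType → G ⧸ K :=
    fun i => if hi : x i ∈ G then ((⟨x i, hi⟩ : G) : G ⧸ K) else ((1 : G) : G ⧸ K)
  have hlt : ∀ i j, i < j → q i ≠ q j := by
    intro i j hij
    obtain ⟨hi, hj, hne⟩ := hpair i j hij
    simpa only [q, hi, hj, dif_pos] using hne
  have hq : q.Injective := by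
    intro i j hij
    by_contra hne
    rcases lt_or_gt_of_ne hne with h | h
    · exact hlt i j h hij
    · exact hlt j i h hij.symm
  have := mk_le_of_injective hq
  rw [mk_ord_toType] at this
  exact this.not_gt (cantor _)

/-- Over some small set, automorphisms fix all cosets of `G000` setwise. -/
theorem exists_fix_cosets (hM : IsMonster L κ M) (hG : IsTypeDefinableGroup L κ G)
    (hA : #A < κ) : ∃ B : Set M, #B < κ ∧ ∀ σ : M ≃[L] M, (∀ b ∈ B, σ b = b) → ∀ g : G,
      ∃ n ∈ G000 L κ G A, (g * n).1 = σ ∘ g.1 := by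
  obtain ⟨B, hB, hAB, hGB, hmul⟩ := hG.exists_base hM hA
  -- Adding representatives of all cosets to the parameters makes automorphisms fix them; invariance
  -- of `G000` then keeps each element in its coset.
  let rep : (G ⧸ G000 L κ G A) × I → M := fun p => p.1.out.1 p.2
  refine ⟨B ∪ Set.range rep, hM.mk_union_lt hB (IsMonster.mk_range_lt
    (hM.mk_prod_lt (mk_quotient_G000_lt hM hG hA) hG.index_small) rep), fun σ hσ g => ?_⟩
  have hσB : ∀ b ∈ B, σ b = b := fun b hb => hσ b (Or.inl hb)
  let c : G := (g : G ⧸ G000 L κ G A).out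
  have hc : c.1 = σ ∘ c.1 := funext fun i => (hσ _ (Or.inr ⟨(_, i), rfl⟩)).symm
  have hn : c⁻¹ * g ∈ G000 L κ G A := QuotientGroup.eq.1 (QuotientGroup.out_eq' _)
  let g' : G := ⟨_, hGB.map hσB g.2⟩
  have hn' : c⁻¹ * g' ∈ G000 L κ G A := G000_map (fun a ha => hσB a (hAB ha))
    (inv_mul_map hGB hmul hσB hc rfl) hn
  refine ⟨(c⁻¹ * g)⁻¹ * (c⁻¹ * g'), mul_mem (inv_mem hn) hn', ?_⟩
  rw [show g * ((c⁻¹ * g)⁻¹ * (c⁻¹ * g')) = g' by group]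

end Component

/-! ### Orbital relations and the logic topology -/

section Relation

variable {E : Setoid X}

theorem mem_classStabilizer {g : G} :
    g ∈ classStabilizer G E ↔ ∀ x, E (g • x) x := by
  simp only [classStabilizer, Subgroup.mem_iInf, MulAction.mem_stabilizer_iff]
  constructor
  · intro h x
    have hx : x ∈ {y | E y x} := E.refl x
    have := Set.smul_mem_smul_set (a := g) hx
    rwa [h _ (E.mem_classes x)] at this
  · rintro h _ ⟨x, rfl⟩
    ext z
    rw [Set.mem_smul_set_iff_inv_smul_mem]
    have hz : E z (g⁻¹ • z) := by simpa using h (g⁻¹ • z)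
    exact ⟨fun h' => E.trans hz h', fun h' => E.trans (E.symm hz) h'⟩

/-- Any `H` with `E = E_H` is contained in H_E, while H_E-orbits stay inside classes, so both groups
have the same orbits. -/
theorem IsOrbital.iff_exists (hE : IsOrbital G E) {x y : X} :
    E x y ↔ ∃ h ∈ classStabilizer G E, h • y = x := by
  constructor
  · intro hxy
    obtain ⟨-, H, hH⟩ := hE
    have hrel : ∀ x y, E x y ↔ ∃ h : H, h • y = x := by
      intro x y
      rw [hH]
      rfl
    obtain ⟨h, hh⟩ := (hrel x y).1 hxy
    exact ⟨h, mem_classStabilizer.2 fun z => (hrel _ _).2 ⟨h, rfl⟩, hh⟩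
  · rintro ⟨h, hh, rfl⟩
    exact mem_classStabilizer.1 hh y

theorem IsOrbital.eq_orbitRel (hE : IsOrbital G E) :
    E = MulAction.orbitRel (classStabilizer G E) X := by
  refine Setoid.ext fun x y => hE.iff_exists.trans ?_
  exact ⟨fun ⟨h, hh, e⟩ => ⟨⟨h, hh⟩, e⟩, fun ⟨h, e⟩ => ⟨h, h.2, e⟩⟩

theorem smul_rel_of_classes {N : Subgroup G} (h : ∀ C ∈ E.classes, ∀ g ∈ N, g • C = C) {n : G}
    (hn : n ∈ N) (x : X) : E (n • x) x := by
  have hx : x ∈ {y | E y x} := E.refl x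
  have := Set.smul_mem_smul_set (a := n) hx
  rwa [h _ (E.mem_classes x) n hn] at this

/-- Classes lie inside G-orbits. Conversely, the class of `g • x` depends only on `x` and the coset
of `g` modulo `G000`, so each orbit contains a small number of classes. -/
theorem mk_quotient_lt_iff (hM : IsMonster L κ M) (hG : IsTypeDefinableGroup L κ G)
    (hA : #A < κ) (hE : IsOrbital G E) (hN : ∀ n ∈ G000 L κ G A, ∀ x : X, E (n • x) x) :
    #(Quotient E) < κ ↔ #(MulAction.orbitRel.Quotient G X) < κ := by
  constructor
  · refine fun h => lt_of_le_of_lt (mk_le_of_surjective (f := Quotient.map' (s₁ := E)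
      (s₂ := MulAction.orbitRel G X) id fun x y hxy => ?_) ?_) h
    · obtain ⟨h, -, rfl⟩ := hE.iff_exists.1 hxy
      exact ⟨h, rfl⟩
    · rintro ⟨x⟩
      exact ⟨Quotient.mk E x, rfl⟩
  · intro h
    let f : MulAction.orbitRel.Quotient G X × (G ⧸ G000 L κ G A) → Quotient E :=
      fun p => Quotient.mk E (p.2.out • p.1.out)
    refine lt_of_le_of_lt (mk_le_of_surjective (f := f) ?_)
      (hM.mk_prod_lt h (mk_quotient_G000_lt hM hG hA))
    rintro ⟨y⟩
    let x : X := (Quotient.mk (MulAction.orbitRel G X) y).out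
    obtain ⟨g, hg⟩ : ∃ g : G, g • x = y :=
      (MulAction.orbitRel G X).symm (Quotient.mk_out (s := MulAction.orbitRel G X) y)
    refine ⟨(Quotient.mk _ y, (g : G ⧸ G000 L κ G A)), Quotient.sound ?_⟩
    let c : G := (g : G ⧸ G000 L κ G A).out
    have hn : c⁻¹ * g ∈ G000 L κ G A := QuotientGroup.eq.1 (QuotientGroup.out_eq' _)
    have h1 := (hE.1 c _ _).1 (hN _ hn x)
    rw [smul_smul, mul_inv_cancel_left, hg] at h1
    exact E.symm h1

/-- `E` is the projection of the graph of the action restricted to `H`, with the two points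
exchanged. -/
theorem typeDefinable_rel_of_subgroup (hM : IsMonster L κ M) (hG : IsTypeDefinableGroup L κ G)
    (hX : IsTypeDefinableAction L κ G X) {H : Subgroup G}
    (hH : TypeDefinable L κ (asTuples (H : Set G))) (hE : E = MulAction.orbitRel H X) :
    TypeDefinable L κ (relTuples fun x y : X => E x y) := by
  obtain ⟨B₁, hB₁, h₁⟩ := hH.exists_closedOver
  obtain ⟨B₂, hB₂, h₂⟩ := hX.smul.exists_closedOver
  have hI := hG.index_small
  have hJ := hX.index_small
  have hB := hM.mk_union_lt hB₁ hB₂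
  let swap : J ⊕ J → I ⊕ J ⊕ J := Sum.elim (fun j => Sum.inr (Sum.inr j))
    (fun j => Sum.inr (Sum.inl j))
  have hswap : swap.Injective := by
    rintro (i | i) (j | j) h <;> simp_all [swap]
  have key := hM.closedOver_image_comp (hM.mk_sum_lt hI (hM.mk_sum_lt hJ hJ)) (hM.mk_sum_lt hJ hJ)
    hB (((h₁.preimage_comp (Sum.inl : I → I ⊕ J ⊕ J)).mono Set.subset_union_left).inter
      (h₂.mono Set.subset_union_right)) hswap
  refine hM.typeDefinable_of_closedOver (hM.mk_sum_lt hJ hJ) hB ?_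
  convert key using 1
  ext t
  constructor
  · rintro ⟨x, y, hxy, rfl⟩
    rw [hE] at hxy
    obtain ⟨h, rfl⟩ := hxy
    refine ⟨_, ⟨⟨h.1, h.2, ?_⟩, h.1, y, rfl⟩, ?_⟩
    · rfl
    · funext j
      rcases j with j | j <;> rfl
  · rintro ⟨_, ⟨⟨h, hh, hg⟩, g, y, rfl⟩, rfl⟩
    obtain rfl : h = g := Subtype.ext hg
    refine ⟨h • y, y, ?_, ?_⟩
    · rw [hE]
      exact ⟨⟨h, hh⟩, rfl⟩
    · funext j
      rcases j with j | j <;> rfl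

theorem typeDefinable_class (hM : IsMonster L κ M) (hX : #J < κ)
    (hE : TypeDefinable L κ (relTuples fun x y : X => E x y)) {C : Set X} (hC : C ∈ E.classes) :
    TypeDefinable L κ (asTuples C) := by
  obtain ⟨x, rfl⟩ := hC
  obtain ⟨B, hB, h⟩ := hE.exists_closedOver
  have hx := IsMonster.mk_range_lt hX x.1
  have hBx := hM.mk_union_lt hB hx
  have key := hM.closedOver_image_comp (hM.mk_sum_lt hX hX) hX hBx
    ((h.mono Set.subset_union_left).inter (((ClosedOver.singleton (L := L) x.1).preimage_comp
      (Sum.inr : J → J ⊕ J)).mono Set.subset_union_right)) (f := Sum.inl) Sum.inl_injective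
  refine hM.typeDefinable_of_closedOver hX hBx ?_
  convert key using 1
  ext t
  constructor
  · rintro ⟨y, hy, rfl⟩
    exact ⟨Sum.elim y.1 x.1, ⟨⟨y, x, hy, rfl⟩, rfl⟩, rfl⟩
  · rintro ⟨_, ⟨⟨y, z, hyz, rfl⟩, hz⟩, rfl⟩
    obtain rfl : z = x := Subtype.ext hz
    exact ⟨y, hyz, rfl⟩

theorem typeDefinable_classStabilizer (hM : IsMonster L κ M) (hG : IsTypeDefinableGroup L κ G)
    (hX : IsTypeDefinableAction L κ G X) (hA : #A < κ) (hE : IsInvariantRel G E)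
    (hN : ∀ n ∈ G000 L κ G A, ∀ x : X, E (n • x) x)
    (hC : ∀ C ∈ E.classes, TypeDefinable L κ (asTuples C)) :
    TypeDefinable L κ (asTuples (classStabilizer G E : Set G)) := by
  obtain ⟨B, hB, hfix⟩ := exists_fix_cosets hM hG hA
  obtain ⟨B₀, hB₀, hG₀⟩ := hG.carrier.exists_closedOver
  obtain ⟨B₁, hB₁, h₁⟩ := hX.smul.exists_closedOver
  have hI := hG.index_small
  have hJ := hX.index_small
  have hS : ∀ x : X, TypeDefinable L κ (asTuples {g : G | E (g • x) x}) := by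
    intro x
    obtain ⟨B₂, hB₂, h₂⟩ := (hC _ (E.mem_classes x)).exists_closedOver
    have hx := IsMonster.mk_range_lt hJ x.1
    have hB' := hM.mk_union_lt (hM.mk_union_lt hB₁ hB₂) hx
    have key := hM.closedOver_image_comp (hM.mk_sum_lt hI (hM.mk_sum_lt hJ hJ)) hI hB'
      (((h₁.mono Set.subset_union_left).mono Set.subset_union_left).inter
        ((((h₂.preimage_comp (fun j => Sum.inr (Sum.inr j) : J → I ⊕ J ⊕ J)).mono
          Set.subset_union_right).mono Set.subset_union_left).inter
          (((ClosedOver.singleton (L := L) x.1).preimage_comp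
            (fun j => Sum.inr (Sum.inl j) : J → I ⊕ J ⊕ J)).mono Set.subset_union_right)))
      (f := Sum.inl) Sum.inl_injective
    refine hM.typeDefinable_of_closedOver hI hB' ?_
    convert key using 1
    ext t
    constructor
    · rintro ⟨g, hg, rfl⟩
      exact ⟨_, ⟨⟨g, x, rfl⟩, ⟨g • x, hg, rfl⟩, rfl⟩, rfl⟩
    · rintro ⟨_, ⟨⟨g, z, rfl⟩, ⟨y, hy, hyg⟩, hz⟩, rfl⟩
      obtain rfl : z = x := Subtype.ext hz
      obtain rfl : y = g • z := Subtype.ext hyg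
      exact ⟨g, hy, rfl⟩
  have hB' := hM.mk_union_lt hB hB₀
  refine hM.typeDefinable_of_closedOver hI hB' ?_
  have key := (hG₀.mono (Set.subset_union_right (s := B))).inter
    (ClosedOver.iInter fun x : X => hM.closedOver_of_invariant hI hB' (hS x) (by
      rintro σ hσ _ ⟨g, hg, rfl⟩
      obtain ⟨n, hn, hgn⟩ := hfix σ (fun b hb => hσ b (Or.inl hb)) g
      -- The automorphism moves `g` within its coset of `G000`, so `g • x` stays in its class. This
      -- holds over the same parameters for every `x`, so the intersection over all `x` needs no
      -- more.
      refine ⟨g * n, ?_, hgn⟩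
      have h := (hE g _ _).1 (hN n hn x)
      rw [smul_smul] at h
      exact E.trans h hg))
  convert key using 1
  ext t
  simp only [Set.mem_inter_iff, Set.mem_iInter]
  constructor
  · rintro ⟨g, hg, rfl⟩
    exact ⟨g.2, fun x => ⟨g, mem_classStabilizer.1 hg x, rfl⟩⟩
  · rintro ⟨ht, h⟩
    refine ⟨⟨t, ht⟩, mem_classStabilizer.2 fun x => ?_, rfl⟩
    obtain ⟨g, hg, hgt⟩ := h x
    obtain rfl : g = ⟨t, ht⟩ := Subtype.ext hgt
    exact hg

/-- If `E` is bounded, then automorphisms over some small set fix all `E`-classes setwise. -/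
theorem exists_fix_classes (hM : IsMonster L κ M) (hG : IsTypeDefinableGroup L κ G)
    (hX : IsTypeDefinableAction L κ G X) (hA : #A < κ) (hE : IsOrbital G E)
    (hN : ∀ n ∈ G000 L κ G A, ∀ x : X, E (n • x) x) (hbd : #(Quotient E) < κ) :
    ∃ B : Set M, #B < κ ∧ ClosedOver L B X ∧ ∀ σ : M ≃[L] M, (∀ b ∈ B, σ b = b) → ∀ y : X,
      ∃ y' : X, y'.1 = σ ∘ y.1 ∧ E y' y := by
  obtain ⟨B, hB, hfix⟩ := exists_fix_cosets hM hG hA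
  obtain ⟨B₁, hB₁, h₁⟩ := hX.smul.exists_closedOver
  obtain ⟨B₂, hB₂, h₂⟩ := hX.carrier.exists_closedOver
  let rep : Quotient E × J → M := fun p => p.1.out.1 p.2
  refine ⟨(B ∪ B₁) ∪ (B₂ ∪ Set.range rep), hM.mk_union_lt (hM.mk_union_lt hB hB₁)
    (hM.mk_union_lt hB₂ (IsMonster.mk_range_lt (hM.mk_prod_lt hbd hX.index_small) rep)),
    h₂.mono (Set.subset_union_left.trans Set.subset_union_right), fun σ hσ y => ?_⟩
  -- The chosen representative is fixed by `σ`; writing `y = h • x`, the automorphism only changes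
  -- `h` within its coset.
  let x : X := (Quotient.mk E y).out
  have hx : x.1 = σ ∘ x.1 := funext fun i => (hσ _ (Or.inr (Or.inr ⟨(_, i), rfl⟩))).symm
  obtain ⟨h, -, hh⟩ := hE.iff_exists.1 (E.symm (Quotient.mk_out y : E x y))
  obtain ⟨n, hn, hhn⟩ := hfix σ (fun b hb => hσ b (Or.inl (Or.inl hb))) h
  refine ⟨(h * n) • x, ?_, ?_⟩
  · rw [← hh]
    exact graph₂_map h₁ (fun b hb => hσ b (Or.inl (Or.inr hb))) hhn hx
  · rw [← hh, mul_smul]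
    exact (hE.1 h _ _).1 (hN n hn x)

/-- Preimages of sets of classes are invariant over `B`, so a type-definable one is type-definable
over `B` itself; hence arbitrary intersections need no new parameters. -/
theorem exists_isLogicTopology (hM : IsMonster L κ M) (hJ : #J < κ) (hB : #B < κ)
    (hXB : ClosedOver L B X) (hfix : ∀ σ : M ≃[L] M, (∀ b ∈ B, σ b = b) → ∀ y : X,
      ∃ y' : X, y'.1 = σ ∘ y.1 ∧ E y' y) :
    ∃ τ : TopologicalSpace (Quotient E), IsLogicTopology L κ E τ := by
  let pre : Set (Quotient E) → Set (J → M) := fun C => asTuples {x : X | Quotient.mk E x ∈ C}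
  have hpre : ∀ (C : Set (Quotient E)) (x : X), x.1 ∈ pre C ↔ Quotient.mk E x ∈ C := fun C x =>
    ⟨fun ⟨y, hy, e⟩ => Subtype.ext e ▸ hy, fun h => ⟨x, h, rfl⟩⟩
  have hiff : ∀ C, ClosedOver L B (pre C) ↔ TypeDefinable L κ (pre C) := by
    refine fun C => ⟨hM.typeDefinable_of_closedOver hJ hB,
      fun h => hM.closedOver_of_invariant hJ hB h ?_⟩
    rintro σ hσ _ ⟨y, hy, rfl⟩
    obtain ⟨y', h1, h2⟩ := hfix σ hσ y
    refine ⟨y', ?_, h1⟩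
    rw [Set.mem_ofPred_eq, show Quotient.mk E y' = Quotient.mk E y from Quotient.sound h2]
    exact hy
  refine ⟨TopologicalSpace.ofClosed {C | ClosedOver L B (pre C)} ?_ ?_ ?_, fun C => ?_⟩
  · have : pre ∅ = ∅ := by simp [pre, asTuples]
    rw [Set.mem_ofPred_eq, this]
    exact .of_definable Set.definable_empty
  · intro S hS
    have : pre (⋂₀ S) = X ∩ ⋂ C : S, pre C := by
      ext t
      simp only [Set.mem_inter_iff, Set.mem_iInter]
      constructor
      · rintro ⟨x, hx, rfl⟩
        exact ⟨x.2, fun C => (hpre _ x).2 (hx C C.2)⟩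
      · rintro ⟨ht, h⟩
        exact (hpre _ ⟨t, ht⟩).2 fun C hC => (hpre C ⟨t, ht⟩).1 (h ⟨C, hC⟩)
    rw [Set.mem_ofPred_eq, this]
    exact hXB.inter (.iInter fun C => hS C.2)
  · intro C hC C' hC'
    have : pre (C ∪ C') = pre C ∪ pre C' := by
      exact Set.image_union (Subtype.val : X → J → M) {x | Quotient.mk E x ∈ C}
        {x | Quotient.mk E x ∈ C'}
    rw [Set.mem_ofPred_eq, this]
    exact ClosedOver.union hC hC'
  · rw [← hiff, ← @isOpen_compl_iff]
    change Cᶜᶜ ∈ {C | ClosedOver L B (pre C)} ↔ _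
    rw [compl_compl]
    rfl

theorem t2Space_of_typeDefinable (hM : IsMonster L κ M) (hJ : #J < κ)
    (hE : TypeDefinable L κ (relTuples fun x y : X => E x y)) {τ : TopologicalSpace (Quotient E)}
    (hτ : IsLogicTopology L κ E τ) : T2Space (Quotient E) := by
  -- Saturations of definable sets under `E` are closed, being projections of type-definable sets.
  have himage : ∀ {B : Set M} {D : Set (J → M)}, #B < κ → B.Definable L D →
      IsClosed {p : Quotient E | ∃ w : X, Quotient.mk E w = p ∧ w.1 ∈ D} := by
    intro B D hB hD
    obtain ⟨B', hB', h⟩ := hE.exists_closedOver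
    have hBB := hM.mk_union_lt hB' hB
    have key := hM.closedOver_image_comp (hM.mk_sum_lt hJ hJ) hJ hBB
      ((h.mono Set.subset_union_left).inter (((ClosedOver.of_definable hD).preimage_comp
        (Sum.inl : J → J ⊕ J)).mono Set.subset_union_right)) (f := Sum.inr) Sum.inr_injective
    refine (hτ _).2 (hM.typeDefinable_of_closedOver hJ hBB ?_)
    convert key using 1
    ext t
    constructor
    · rintro ⟨z, ⟨w, hwz, hw⟩, rfl⟩
      exact ⟨Sum.elim w.1 z.1, ⟨⟨w, z, Quotient.exact hwz, rfl⟩, hw⟩, rfl⟩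
    · rintro ⟨_, ⟨⟨w, z, hwz, rfl⟩, hw⟩, rfl⟩
      exact ⟨z, ⟨w, Quotient.sound hwz, hw⟩, rfl⟩
  refine ⟨fun p q hpq => ?_⟩
  obtain ⟨x, rfl⟩ := Quotient.exists_rep p
  obtain ⟨y, rfl⟩ := Quotient.exists_rep q
  have hxy : ¬ E x y := fun h => hpq (Quotient.sound h)
  obtain ⟨B₁, hB₁, h₁⟩ := (typeDefinable_class hM hJ hE (E.mem_classes x)).exists_closedOver
  obtain ⟨B₂, hB₂, h₂⟩ := (typeDefinable_class hM hJ hE (E.mem_classes y)).exists_closedOver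
  obtain ⟨D, F, hD, hxD, hF, -, hDF⟩ := hM.exists_separation hJ hB₁ hB₂ h₁
    (T := {D | B₂.Definable L D ∧ asTuples {z | E z y} ⊆ D}) (fun D hD => hD.1) (by
      rw [Set.eq_empty_iff_forall_notMem]
      rintro _ ⟨⟨z, hz, rfl⟩, hzT⟩
      have : z.1 ∈ asTuples {z | E z y} := by
        by_contra hcon
        obtain ⟨D, hD, h1, h2⟩ := h₂ _ hcon
        exact h2 (hzT D ⟨hD, h1⟩)
      obtain ⟨z', hz', e⟩ := this
      obtain rfl : z' = z := Subtype.ext e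
      exact hxy (E.trans (E.symm hz) hz'))
  -- `D` contains the class of `x` and misses that of `y`. The open sets consist of the classes
  -- inside `D` and of those disjoint from `D`.
  refine ⟨_, _, (himage hB₁ hD.compl).isOpen_compl, (himage hB₁ hD).isOpen_compl, ?_, ?_, ?_⟩
  · rintro ⟨w, hw, hwD⟩
    exact hwD (hxD ⟨w, Quotient.exact hw, rfl⟩)
  · rintro ⟨w, hw, hwD⟩
    exact Set.eq_empty_iff_forall_notMem.1 hDF w.1
      ⟨hwD, fun D' hD' => (hF hD').2 ⟨w, Quotient.exact hw, rfl⟩⟩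
  · rw [Set.disjoint_left]
    intro p h1 h2
    obtain ⟨z, rfl⟩ := Quotient.exists_rep p
    exact h1 ⟨z, rfl, fun hz => h2 ⟨z, rfl, hz⟩⟩

theorem typeDefinable_class_of_t1Space {τ : TopologicalSpace (Quotient E)}
    (hτ : IsLogicTopology L κ E τ) [T1Space (Quotient E)] {C : Set X} (hC : C ∈ E.classes) :
    TypeDefinable L κ (asTuples C) := by
  obtain ⟨x, rfl⟩ := hC
  convert (hτ {Quotient.mk E x}).1 isClosed_singleton using 2
  ext y
  exact (Quotient.eq (r := E)).symm

end Relation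

end MonsterModel

theorem mainTheorem6 (L : FirstOrder.Language.{u, u}) (κ : Cardinal.{u}) (M : Type u)
    [L.Structure M] (hM : MonsterModel.IsMonster L κ M)
    {I J : Type u} (G : Set (I → M)) [Group G] (X : Set (J → M)) [MulAction G X]
    (hG : MonsterModel.IsTypeDefinableGroup L κ G)
    (hX : MonsterModel.IsTypeDefinableAction L κ G X)
    (E : Setoid X) (hE : MonsterModel.IsOrbital G E)
    (A : Set M) (hA : Cardinal.mk A < κ)
    (hEA : ∀ C ∈ E.classes, ∀ g ∈ MonsterModel.G000 L κ G A, g • C = C) :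
    List.TFAE [
      MonsterModel.TypeDefinable L κ (MonsterModel.relTuples fun x y : X => E x y),
      ∀ C ∈ E.classes, MonsterModel.TypeDefinable L κ (MonsterModel.asTuples C),
      MonsterModel.TypeDefinable L κ
        (MonsterModel.asTuples (MonsterModel.classStabilizer G E : Set G)),
      ∃ H : Subgroup G, MonsterModel.TypeDefinable L κ (MonsterModel.asTuples (H : Set G)) ∧
        E = MulAction.orbitRel H X] ∧
    (Cardinal.mk (Quotient E) < κ ↔ Cardinal.mk (MulAction.orbitRel.Quotient G X) < κ) ∧
    (Cardinal.mk (Quotient E) < κ →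
      ∃ τ : TopologicalSpace (Quotient E), MonsterModel.IsLogicTopology L κ E τ ∧
        (MonsterModel.TypeDefinable L κ (MonsterModel.relTuples fun x y : X => E x y) ↔
          @T2Space (Quotient E) τ)) := by

  have hN : ∀ n ∈ MonsterModel.G000 L κ G A, ∀ x : X, E (n • x) x :=
    fun n hn => MonsterModel.smul_rel_of_classes hEA hn
  have hJ := hX.index_small
  have htfae : List.TFAE [
      MonsterModel.TypeDefinable L κ (MonsterModel.relTuples fun x y : X => E x y),
      ∀ C ∈ E.classes, MonsterModel.TypeDefinable L κ (MonsterModel.asTuples C),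
      MonsterModel.TypeDefinable L κ
        (MonsterModel.asTuples (MonsterModel.classStabilizer G E : Set G)),
      ∃ H : Subgroup G, MonsterModel.TypeDefinable L κ (MonsterModel.asTuples (H : Set G)) ∧
        E = MulAction.orbitRel H X] := by
    tfae_have 1 → 2 := fun h _ => MonsterModel.typeDefinable_class hM hJ h
    tfae_have 2 → 3 := MonsterModel.typeDefinable_classStabilizer hM hG hX hA hE.1 hN
    tfae_have 3 → 4 := fun h => ⟨_, h, hE.eq_orbitRel⟩
    tfae_have 4 → 1 := fun ⟨_, h, hEH⟩ => MonsterModel.typeDefinable_rel_of_subgroup hM hG hX h hEH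
    tfae_finish
  refine ⟨htfae, MonsterModel.mk_quotient_lt_iff hM hG hA hE hN, fun hbd => ?_⟩
  obtain ⟨B, hB, hXB, hfix⟩ := MonsterModel.exists_fix_classes hM hG hX hA hE hN hbd
  obtain ⟨τ, hτ⟩ := MonsterModel.exists_isLogicTopology hM hJ hB hXB hfix
  refine ⟨τ, hτ, fun h => MonsterModel.t2Space_of_typeDefinable hM hJ h hτ, fun h => ?_⟩
  -- Closed points already suffice: they make the classes type-definable, and the equivalences do
  -- the rest.
  exact (htfae.out 0 1).2 fun C hC => MonsterModel.typeDefinable_class_of_t1Space hτ hC
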